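/- Let $M$ be a smooth ($C^\infty$, Hausdorff, second countable, finite-dimensional, boundaryless) manifold. On $TM\oplus T^*M$ put $\langle X+\alpha,Y+\beta\rangle=\tfrac12(\beta(X)+\alpha(Y))$ and the Courant bracket $[[X+\alpha,Y+\beta]]=[X,Y]+\mathcal L_X\beta-\mathcal L_Y\alpha-\tfrac12 d(\iota_X\beta-\iota_Y\alpha)$; for $E,F\in TM\oplus T^*M$ let $E\otimes F$ be the endomorphism $v\mapsto 2\langle F,v\rangle E$. A normal generalized contact metric structure on $M$ consists of smooth bundle endomorphisms $\Phi,G$ of $TM\oplus T^*M$ and smooth sections $E_\pm$ such that - $\Phi+\Phi^*=0$, $\ \Phi^2=-\mathrm{Id}+E_+\otimes E_-+E_-\otimes E_+$, $\ \langle E_\pm,E_\pm\rangle=0$, $\ 2\langle E_+,E_-\rangle=1$; - $G^*=G$, $G^2=\mathrm{Id}$, $\langle Gv,v\rangle>0$ for $v\neq0$, and $-\Phi G\Phi=G-E_+\otimes E_+-E_-\otimes E_-$; - the smooth sections of $L^+=L_{E_+}\oplus E^{(1,0)}$ and of $L^-=L_{E_-}\oplus E^{(1,0)}$ are each closed under the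 complex bilinear Courant bracket, where $L_{E_\pm}$ is the complex line bundle spanned by $E_\pm$ and $E^{(1,0)}$ is the $\sqrt{-1}$-eigenbundle of $\Phi$ in $(TM\oplus T^*M)\otimes\mathbb C$; and $[[E_+,E_-]]=0$. Its canonical Poisson structure is the bivector $\pi_M=\pi_0+e_+\wedge e_-$, regarded as a bundle map $T^*M\to TM$, where $e_\pm=pr_{TM}E_\pm$, $(e_+\wedge e_-)(\xi)=\xi(e_+)e_--\xi(e_-)e_+$, and $\pi_0(\xi)=pr_{TM}(\Phi\xi)$ for $\xi\in T^*M$. Put $\eta=pr_{T^*M}E_++pr_{T^*M}E_-$. **Theorem 5.1.** Let $(M,\Phi,E_\pm,G)$ be a normal generalized contact metric structure with canonical Poisson structure $\pi_M$. Let $\mathbb R$, with coordinate $t$, carry its standard structure $\Phi=0$, $E_+=dt$, $E_-=\partial/\partial t$, $G$ given by $dt^2$ (so $G$ exchanges $\partial/\partial t$ and $dt$), with canonical Poisson structure $\pi_{\mathbb R}=0$. Let $\pi=\pi_M+\pi_{\mathbb R}$ be the product bivector on $M\times\mathbb R$, and let $B=d(e^t\eta)$, where $\eta$ is pulled back to $M\times\mathbb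 R$ and two-forms act on vectors by $X\mapsto\iota_XB$. Then the bundle map $I+B\pi:T^*(M\times\mathbb R)\to T^*(M\times\mathbb R)$ is invertible (in every fibre) if and only if, for every $t\in\mathbb R$, the bundle map $I+e^t\,d\eta\,\pi_M:T^*M\to T^*M$ is invertible (in every fibre). -/

import Mathlib

open scoped Manifold ContDiff Bundle
open Bundle Set

noncomputable section

namespace GenContact

section Basic

variable {E : Type*} [NormedAddCommGroup E] [NormedSpace ℝ E] {H : Type*} [TopologicalSpace H]
  (I : ModelWithCorners ℝ E H) {M : Type*} [TopologicalSpace M] [ChartedSpace H M]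

/-- The cotangent space `T*_x M`. -/
abbrev Cotangent (x : M) : Type _ := TangentSpace I x →L[ℝ] ℝ

/-- The fibre `T_x M ⊕ T*_x M` of the big tangent bundle. -/
abbrev BigTangent (x : M) : Type _ := TangentSpace I x × (TangentSpace I x →L[ℝ] ℝ)

/-- Smooth sections of `TM ⊕ T*M`. -/
def SmoothSection [IsManifold I ∞ M] (s : Π x : M, BigTangent I x) : Prop :=
  ContMDiff I (I.prod 𝓘(ℝ, E × (E →L[ℝ] ℝ))) ∞
    (fun x ↦ TotalSpace.mk' (E := BigTangent I (M := M)) (E × (E →L[ℝ] ℝ)) x (s x))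

/-- Smooth bundle endomorphisms of `TM ⊕ T*M`, as smooth sections of the endomorphism bundle. -/
def SmoothEndo [IsManifold I ∞ M] (A : Π x : M, BigTangent I x →L[ℝ] BigTangent I x) : Prop :=
  ContMDiff I (I.prod 𝓘(ℝ, (E × (E →L[ℝ] ℝ)) →L[ℝ] (E × (E →L[ℝ] ℝ)))) ∞
    (fun x ↦ TotalSpace.mk' (E := fun x : M ↦ BigTangent I x →L[ℝ] BigTangent I x)
      ((E × (E →L[ℝ] ℝ)) →L[ℝ] (E × (E →L[ℝ] ℝ))) x (A x))

theorem smoothEndo_iff [IsManifold I ∞ M]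
    (A : Π x : M, BigTangent I x →L[ℝ] BigTangent I x) :
    SmoothEndo I A ↔ ∀ x₀ : M, ContMDiffAt I 𝓘(ℝ, (E × (E →L[ℝ] ℝ)) →L[ℝ] (E × (E →L[ℝ] ℝ))) ∞
      (fun x ↦ ContinuousLinearMap.inCoordinates (E × (E →L[ℝ] ℝ)) (BigTangent I (M := M))
        (E × (E →L[ℝ] ℝ)) (BigTangent I (M := M)) x₀ x x₀ x (A x)) x₀ := by
  refine forall_congr' fun x₀ ↦ ?_
  exact (contMDiffAt_hom_bundle _).trans ⟨fun h ↦ h.2, fun h ↦ ⟨contMDiffAt_id, h⟩⟩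

variable {I} in
/-- The neutral metric `⟨X + α, Y + β⟩ = (β(X) + α(Y)) / 2`. -/
def pairing {x : M} (u v : BigTangent I x) : ℝ := (1 / 2) * (v.2 u.1 + u.2 v.1)

/-- The differential of a function, as a one-form. -/
def dFun (f : M → ℝ) (x : M) : Cotangent I x := mfderiv I 𝓘(ℝ, ℝ) f x

/-- The local expression of a one-form `α` in the preferred chart `φ` at `x₀`, that is, the
pullback `(φ⁻¹)^* α` on the model space. -/
def formInChart (α : Π x : M, Cotangent I x) (x₀ : M) (e : E) : E →L[ℝ] ℝ :=
  (α ((extChartAt I x₀).symm e)).comp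
    (mfderivWithin 𝓘(ℝ, E) I (extChartAt I x₀).symm (range I) e)

/-- The exterior derivative of a one-form, `X ↦ ι_X dα`. At `x₀` it is computed in the preferred
chart `φ` at `x₀` by `dα(X, Y) = (D_{X'} α')(Y') - (D_{Y'} α')(X')`, where `α'` is the expression
of `α` in the chart and `X' = dφ(X)`, `Y' = dφ(Y)`. This is the convention
`dα(X, Y) = X(α(Y)) - Y(α(X)) - α([X, Y])`. -/
def dForm (α : Π x : M, Cotangent I x) (x₀ : M) : TangentSpace I x₀ →L[ℝ] Cotangent I x₀ :=
  let D : E →L[ℝ] E →L[ℝ] ℝ :=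
    fderivWithin ℝ (formInChart I α x₀) (range I) (extChartAt I x₀ x₀)
  let A : TangentSpace I x₀ →L[ℝ] E := mfderiv I 𝓘(ℝ, E) (extChartAt I x₀) x₀
  (ContinuousLinearMap.precomp ℝ A).comp ((D - D.flip).comp A)

/-- The Lie derivative `L_X β = ι_X dβ + d(ι_X β)` of a one-form. -/
def lieDerivForm (X : Π x : M, TangentSpace I x) (β : Π x : M, Cotangent I x) (x : M) :
    Cotangent I x :=
  dForm I β x (X x) + dFun I (fun y ↦ β y (X y)) x

/-- The Courant bracket
`[[X + α, Y + β]] = [X, Y] + L_X β - L_Y α - (1/2) d(ι_X β - ι_Y α)`. -/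
def courant (u v : Π x : M, BigTangent I x) (x : M) : BigTangent I x :=
  (VectorField.mlieBracket I (fun y ↦ (u y).1) (fun y ↦ (v y).1) x,
    lieDerivForm I (fun y ↦ (u y).1) (fun y ↦ (v y).2) x
      - lieDerivForm I (fun y ↦ (v y).1) (fun y ↦ (u y).2) x
      - (1 / 2 : ℝ) • dFun I (fun y ↦ (v y).2 (u y).1 - (u y).2 (v y).1) x)

/-- The fibre of the complexified big tangent bundle: the pair `(u, v)` stands for
`u + √-1 v`. -/
abbrev ComplexBigTangent (x : M) : Type _ := BigTangent I x × BigTangent I x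

/-- A family `L` of subsets of the fibres of `(TM ⊕ T*M) ⊗ ℂ` is involutive if the smooth sections
with values in `L` are closed under the complex bilinear extension of the Courant bracket. -/
def IsInvolutive [IsManifold I ∞ M] (L : Π x : M, Set (ComplexBigTangent I x)) : Prop :=
  ∀ u v u' v' : Π x : M, BigTangent I x,
    SmoothSection I u → SmoothSection I v → SmoothSection I u' → SmoothSection I v' →
    (∀ x, (u x, v x) ∈ L x) → (∀ x, (u' x, v' x) ∈ L x) →
    ∀ x, (courant I u u' x - courant I v v' x, courant I u v' x + courant I v u' x) ∈ L x

/-- The sum of the complex line spanned by the real vector `e` and the `√-1`-eigenspace of the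
real endomorphism `Φ`: all `(a + √-1 b) e + w` with `a`, `b` real and `Φ w = √-1 w`. -/
def lineAddEigen {x : M} (Φ : BigTangent I x →L[ℝ] BigTangent I x) (e : BigTangent I x) :
    Set (ComplexBigTangent I x) :=
  {z | ∃ (a b : ℝ) (w₁ w₂ : BigTangent I x), Φ w₁ = -w₂ ∧ Φ w₂ = w₁ ∧
    z = (a • e + w₁, b • e + w₂)}

variable (M) in
/-- A generalized almost contact metric structure `(Φ, E₊, E₋, G)` on `M`. The endomorphism
`E ⊗ F` of `TM ⊕ T*M` is `v ↦ 2⟨F, v⟩ E`. -/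
structure GenAlmostContactMetric [IsManifold I ∞ M] where
  /-- The endomorphism of `TM ⊕ T*M`. -/
  Φ : Π x : M, BigTangent I x →L[ℝ] BigTangent I x
  /-- The section `E₊`. -/
  Ep : Π x : M, BigTangent I x
  /-- The section `E₋`. -/
  Em : Π x : M, BigTangent I x
  /-- The generalized Riemannian metric. -/
  G : Π x : M, BigTangent I x →L[ℝ] BigTangent I x
  smooth_Φ : SmoothEndo I Φ
  smooth_Ep : SmoothSection I Ep
  smooth_Em : SmoothSection I Em
  smooth_G : SmoothEndo I G
  /-- `Φ + Φ^* = 0`. -/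
  Φ_skew : ∀ (x : M) (u v : BigTangent I x), pairing (Φ x u) v + pairing u (Φ x v) = 0
  /-- `Φ ∘ Φ = -Id + E₊ ⊗ E₋ + E₋ ⊗ E₊`. -/
  Φ_sq : ∀ (x : M) (v : BigTangent I x), Φ x (Φ x v) =
    -v + (2 * pairing (Em x) v) • Ep x + (2 * pairing (Ep x) v) • Em x
  Ep_null : ∀ x : M, pairing (Ep x) (Ep x) = 0
  Em_null : ∀ x : M, pairing (Em x) (Em x) = 0
  Ep_Em : ∀ x : M, 2 * pairing (Ep x) (Em x) = 1
  /-- `G^* = G`. -/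
  G_symm : ∀ (x : M) (u v : BigTangent I x), pairing (G x u) v = pairing u (G x v)
  /-- `G² = 1`. -/
  G_sq : ∀ (x : M) (v : BigTangent I x), G x (G x v) = v
  /-- `⟨G ·, ·⟩` is positive definite. -/
  G_pos : ∀ (x : M) (v : BigTangent I x), v ≠ 0 → 0 < pairing (G x v) v
  /-- `-Φ G Φ = G - E₊ ⊗ E₊ - E₋ ⊗ E₋`. -/
  compat : ∀ (x : M) (v : BigTangent I x), -(Φ x (G x (Φ x v))) =
    G x v - (2 * pairing (Ep x) v) • Ep x - (2 * pairing (Em x) v) • Em x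

variable {I}

/-- The bivector `a ∧ b`, as the map `ξ ↦ ι_ξ (a ∧ b) = ξ(a) b - ξ(b) a`. -/
def wedge {x : M} (a b : TangentSpace I x) : Cotangent I x →L[ℝ] TangentSpace I x where
  toFun := fun ξ ↦ ξ a • b - ξ b • a
  map_add' := fun ξ ζ ↦ by simp only [add_apply, add_smul]; abel
  map_smul' := fun c ξ ↦ by
    simp only [smul_apply, smul_eq_mul, mul_smul, smul_sub, RingHom.id_apply]
  cont := ((continuous_eval_const a).smul continuous_const).sub
    ((continuous_eval_const b).smul continuous_const)

namespace GenAlmostContactMetric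

variable [IsManifold I ∞ M] (S : GenAlmostContactMetric I M)

/-- Both `L⁺ = L_{E₊} ⊕ E^{(1,0)}` and `L⁻ = L_{E₋} ⊕ E^{(1,0)}` are closed under the Courant
bracket. -/
def IsStrong : Prop :=
  IsInvolutive I (fun x : M ↦ lineAddEigen I (S.Φ x) (S.Ep x)) ∧
    IsInvolutive I (fun x : M ↦ lineAddEigen I (S.Φ x) (S.Em x))

/-- The structure is normal: it is strong and `[[E₊, E₋]] = 0`. -/
def IsNormal : Prop := S.IsStrong ∧ ∀ x : M, courant I S.Ep S.Em x = 0

/-- The bivector `π₀ : T*M → TM` underlying `Φ`, `π₀(ξ) = pr_{TM} (Φ ξ)`. Since `Φ` vanishes on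
`E₊` and `E₋`, this is the bivector of the restriction of `Φ` to the orthogonal complement of
`E₊` and `E₋`, extended by zero. -/
def bivectorZero (x : M) : Cotangent I x →L[ℝ] TangentSpace I x :=
  (ContinuousLinearMap.fst ℝ (TangentSpace I x) (Cotangent I x)).comp
    ((S.Φ x).comp (ContinuousLinearMap.inr ℝ (TangentSpace I x) (Cotangent I x)))

/-- The canonical Poisson structure `π_M = π₀ + e₊ ∧ e₋`, where `e₊` and `e₋` are the vector field
parts of `E₊` and `E₋`. -/
def poisson (x : M) : Cotangent I x →L[ℝ] TangentSpace I x :=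
  S.bivectorZero x + wedge (S.Ep x).1 (S.Em x).1

/-- The one-form `η = pr_{T*M} E₊ + pr_{T*M} E₋`. -/
def eta (x : M) : Cotangent I x := (S.Ep x).2 + (S.Em x).2

end GenAlmostContactMetric

end Basic

section Product

variable {E : Type*} [NormedAddCommGroup E] [NormedSpace ℝ E] {H : Type*} [TopologicalSpace H]
  {I : ModelWithCorners ℝ E H} {M : Type*} [TopologicalSpace M] [ChartedSpace H M]
  {E' : Type*} [NormedAddCommGroup E'] [NormedSpace ℝ E'] {H' : Type*} [TopologicalSpace H']
  {J : ModelWithCorners ℝ E' H'} {N : Type*} [TopologicalSpace N] [ChartedSpace H' N]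

/-- The product bivector `π₁ + π₂` on `M × N`: at `(x, y)` each summand is pushed forward along
the inclusion of the slice `M × {y}`, respectively `{x} × N`. -/
def prodBivector (π₁ : Π x : M, Cotangent I x →L[ℝ] TangentSpace I x)
    (π₂ : Π y : N, Cotangent J y →L[ℝ] TangentSpace J y) (p : M × N) :
    Cotangent (I.prod J) p →L[ℝ] TangentSpace (I.prod J) p :=
  let i : TangentSpace I p.1 →L[ℝ] TangentSpace (I.prod J) p :=
    mfderiv I (I.prod J) (fun x : M ↦ (x, p.2)) p.1
  let j : TangentSpace J p.2 →L[ℝ] TangentSpace (I.prod J) p :=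
    mfderiv J (I.prod J) (fun y : N ↦ (p.1, y)) p.2
  i.comp ((π₁ p.1).comp (ContinuousLinearMap.precomp ℝ i)) +
    j.comp ((π₂ p.2).comp (ContinuousLinearMap.precomp ℝ j))

/-- The one-form `e^t α` on `M × ℝ`, where `α` is a one-form on `M` (pulled back along the
projection) and `t` is the coordinate of `ℝ`. -/
def expForm (α : Π x : M, Cotangent I x) (p : M × ℝ) : Cotangent (I.prod 𝓘(ℝ, ℝ)) p :=
  Real.exp p.2 • (α p.1).comp (mfderiv (I.prod 𝓘(ℝ, ℝ)) I Prod.fst p)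

/-- For a bundle map `P : T*M → TM` and a two-form `B : TM → T*M`, the bundle map
`I + B P : T*M → T*M` is invertible (in every fibre). -/
def InvertibleGauge (B : Π x : M, TangentSpace I x →L[ℝ] Cotangent I x)
    (P : Π x : M, Cotangent I x →L[ℝ] TangentSpace I x) : Prop :=
  ∀ x : M, Function.Bijective (fun ξ : Cotangent I x ↦ ξ + B x (P x ξ))

end Product

section Line

/-- The section `dt` of `Tℝ ⊕ T*ℝ`. -/
def lineEp (t : ℝ) : BigTangent 𝓘(ℝ, ℝ) t := ((0 : ℝ), ContinuousLinearMap.id ℝ ℝ)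

/-- The section `∂/∂t` of `Tℝ ⊕ T*ℝ`. -/
def lineEm (t : ℝ) : BigTangent 𝓘(ℝ, ℝ) t := ((1 : ℝ), (0 : ℝ →L[ℝ] ℝ))

/-- The generalized metric of the Euclidean metric `dt²`, exchanging `∂/∂t` and `dt`. -/
def lineG (t : ℝ) : BigTangent 𝓘(ℝ, ℝ) t →L[ℝ] BigTangent 𝓘(ℝ, ℝ) t :=
  (((ContinuousLinearMap.apply ℝ ℝ (1 : ℝ)).comp (ContinuousLinearMap.snd ℝ ℝ (ℝ →L[ℝ] ℝ))).prod
    (((ContinuousLinearMap.id ℝ ℝ).smulRight (ContinuousLinearMap.id ℝ ℝ)).comp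
      (ContinuousLinearMap.fst ℝ ℝ (ℝ →L[ℝ] ℝ))) :
    (ℝ × (ℝ →L[ℝ] ℝ)) →L[ℝ] ℝ × (ℝ →L[ℝ] ℝ))

theorem line_form_apply (c : ℝ →L[ℝ] ℝ) (r : ℝ) : c r = r * c 1 := by
  conv_lhs => rw [← mul_one r, ← smul_eq_mul, map_smul, smul_eq_mul]

theorem line_form_ext {c d : ℝ →L[ℝ] ℝ} (h : c 1 = d 1) : c = d := by
  ext
  exact h

theorem line_trivialization (t x : ℝ) (c : ℝ × (ℝ →L[ℝ] ℝ)) :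
    (trivializationAt (ℝ × (ℝ →L[ℝ] ℝ)) (BigTangent 𝓘(ℝ, ℝ) (M := ℝ)) t ⟨x, c⟩).2 = c := by
  refine Prod.ext ?_ ?_
  · change (trivializationAt ℝ (TangentSpace 𝓘(ℝ, ℝ) (M := ℝ)) t ⟨x, c.1⟩).2 = c.1
    simp
  · change (trivializationAt (ℝ →L[ℝ] ℝ)
      (fun x : ℝ ↦ TangentSpace 𝓘(ℝ, ℝ) x →L[ℝ] Trivial ℝ ℝ x) t ⟨x, c.2⟩).2 = c.2
    rw [hom_trivializationAt_apply]
    refine line_form_ext ?_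
    simp [ContinuousLinearMap.inCoordinates]
    rfl

/-- A section of the big tangent bundle of `ℝ` with constant coordinates is smooth. -/
theorem line_smoothSection_const (c : ℝ × (ℝ →L[ℝ] ℝ)) :
    SmoothSection 𝓘(ℝ, ℝ) (M := ℝ) (fun _ ↦ c) := by
  intro t
  refine (contMDiffAt_section (E := BigTangent 𝓘(ℝ, ℝ) (M := ℝ)) t).2 ?_
  exact contMDiffAt_const (c := c) |>.congr_of_eventuallyEq
    (.of_forall fun x ↦ line_trivialization t x c)

/-- A bundle endomorphism with constant coordinates is smooth. -/
theorem line_smoothEndo_const (A : (ℝ × (ℝ →L[ℝ] ℝ)) →L[ℝ] (ℝ × (ℝ →L[ℝ] ℝ))) :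
    SmoothEndo 𝓘(ℝ, ℝ) (M := ℝ) (fun _ ↦ A) := by
  intro t
  refine (smoothEndo_iff 𝓘(ℝ, ℝ) (M := ℝ) (fun _ ↦ A)).2 (fun t ↦ ?_) t
  refine contMDiffAt_const (c := A) |>.congr_of_eventuallyEq (.of_forall fun x ↦ ?_)
  let e := trivializationAt (ℝ × (ℝ →L[ℝ] ℝ)) (BigTangent 𝓘(ℝ, ℝ) (M := ℝ)) t
  have hx : x ∈ e.baseSet := by
    change x ∈ (trivializationAt ℝ (TangentSpace 𝓘(ℝ, ℝ) (M := ℝ)) t).baseSet ∩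
      ((trivializationAt ℝ (TangentSpace 𝓘(ℝ, ℝ) (M := ℝ)) t).baseSet ∩ univ)
    have : x ∈ (trivializationAt ℝ (TangentSpace 𝓘(ℝ, ℝ) (M := ℝ)) t).baseSet := by
      rw [TangentBundle.trivializationAt_baseSet, chartAt_self_eq]
      exact mem_univ x
    exact ⟨this, this, mem_univ x⟩
  have h₁ (c : ℝ × (ℝ →L[ℝ] ℝ)) : e.continuousLinearMapAt ℝ x c = c := by
    exact (congrFun (e.coe_linearMapAt_of_mem (R := ℝ) hx) c).trans (line_trivialization t x c)
  have h₂ (c : ℝ × (ℝ →L[ℝ] ℝ)) : e.symmL ℝ x c = c :=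
    (h₁ (e.symmL ℝ x c)).symm.trans (e.continuousLinearMapAt_symmL hx c)
  refine ContinuousLinearMap.ext fun c ↦ ?_
  change e.continuousLinearMapAt ℝ x (A (e.symmL ℝ x c)) = A c
  rw [h₂]
  exact h₁ (A c)

/-- The standard structure on `ℝ`: `Φ = 0`, `E₊ = dt`, `E₋ = ∂/∂t`. -/
def line : GenAlmostContactMetric 𝓘(ℝ, ℝ) ℝ where
  Φ _ := 0
  Ep := lineEp
  Em := lineEm
  G := lineG
  smooth_Φ := line_smoothEndo_const 0
  smooth_Ep := line_smoothSection_const ((0 : ℝ), ContinuousLinearMap.id ℝ ℝ)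
  smooth_Em := line_smoothSection_const ((1 : ℝ), (0 : ℝ →L[ℝ] ℝ))
  smooth_G := line_smoothEndo_const _
  Φ_skew x u v := by simp [pairing]
  Φ_sq := fun _ (⟨a, c⟩ : ℝ × (ℝ →L[ℝ] ℝ)) ↦ by
    refine Prod.ext ?_ (line_form_ext ?_)
    · change (0 : ℝ) = -a + (2 * ((1 / 2) * (c (1 : ℝ) + 0))) * 0 + (2 * ((1 / 2) * (c (0 : ℝ) + a))) * 1
      rw [map_zero]
      ring
    · change (0 : ℝ) = -c (1 : ℝ) + (2 * ((1 / 2) * (c (1 : ℝ) + 0))) * 1 + (2 * ((1 / 2) * (c (0 : ℝ) + a))) * 0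
      ring
  Ep_null x := by
    change (1 / 2 : ℝ) * (0 + 0) = 0
    norm_num
  Em_null x := by
    change (1 / 2 : ℝ) * (0 + 0) = 0
    norm_num
  Ep_Em x := by
    change 2 * ((1 / 2 : ℝ) * (0 + 1)) = 1
    norm_num
  G_symm := fun _ (⟨a, c⟩ : ℝ × (ℝ →L[ℝ] ℝ)) (⟨b, d⟩ : ℝ × (ℝ →L[ℝ] ℝ)) ↦ by
    change (1 / 2 : ℝ) * (d (c (1 : ℝ)) + a * b) = (1 / 2 : ℝ) * (b * a + c (d (1 : ℝ)))
    rw [line_form_apply d, line_form_apply c (d (1 : ℝ))]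
    ring
  G_sq := fun _ (⟨a, c⟩ : ℝ × (ℝ →L[ℝ] ℝ)) ↦ by
    refine Prod.ext ?_ (line_form_ext ?_)
    · change a * 1 = a
      ring
    · change c (1 : ℝ) * 1 = c (1 : ℝ)
      ring
  G_pos := fun _ (⟨a, c⟩ : ℝ × (ℝ →L[ℝ] ℝ)) h ↦ by
    change 0 < (1 / 2 : ℝ) * (c (c (1 : ℝ)) + a * a)
    rw [line_form_apply c]
    by_contra! h'
    have ha : a = 0 := by nlinarith [mul_self_nonneg a, mul_self_nonneg (c (1 : ℝ))]
    have hc : c (1 : ℝ) = 0 := by nlinarith [mul_self_nonneg a, mul_self_nonneg (c (1 : ℝ))]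
    exact h (Prod.ext ha (line_form_ext hc))
  compat := fun _ (⟨a, c⟩ : ℝ × (ℝ →L[ℝ] ℝ)) ↦ by
    refine Prod.ext ?_ (line_form_ext ?_)
    · change -(0 : ℝ) = c (1 : ℝ) - (2 * ((1 / 2) * (c (0 : ℝ) + a))) * 0 - (2 * ((1 / 2) * (c (1 : ℝ) + 0))) * 1
      ring
    · change -(0 : ℝ) = a * 1 - (2 * ((1 / 2) * (c (0 : ℝ) + a))) * 1 - (2 * ((1 / 2) * (c (1 : ℝ) + 0))) * 0
      rw [map_zero]
      ring

end Line

end GenContact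

end

/-! Expand `B = e^t dt ∧ η + e^t dη`. Since `π_ℝ = 0`, the bivector `π` sees only the restriction of
a covector to `TM` and takes values in `TM` (`prodBivector_zero_right`, `line_poisson`). Split `T*(M
× ℝ)` at `(x, t)` as `T*_x M ⊕ ℝ`. The `T*M`-component of `I + Bπ` is then `ζ ↦ ζ + e^t dη(π_M ζ)`,
because `B` restricts to `e^t dη` on slices (`dForm_expForm_apply_inl`). The `dt`-component is `s`
plus a function of `ζ`, coming from `e^t dt ∧ η`. The map is therefore block triangular with a `1`
in the `ℝ`-corner, and the mixed term cannot affect bijectivity (`bijective_add_comp_inl_iff`). The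
equivalence holds fibre by fibre. The analytic input is the differentiability of `η` in charts,
which the product rule for `e^t η` requires. -/

namespace GenContact

/-! ### One-forms in charts: regularity of `η` and the local expression of `e^t α`. -/

section Chart

variable {E : Type*} [NormedAddCommGroup E] [NormedSpace ℝ E] {H : Type*} [TopologicalSpace H]
  {I : ModelWithCorners ℝ E H} {M : Type*} [TopologicalSpace M] [ChartedSpace H M]

/-- Links bundle smoothness to `formInChart`: the cotangent trivialization is precomposition with
the inverse tangent trivialization, which is the derivative of the inverse chart. -/
theorem bigTangent_trivializationAt_snd [IsManifold I ∞ M] {x₀ x : M}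
    (hx : x ∈ (chartAt H x₀).source) (c : BigTangent I x) :
    (trivializationAt (E × (E →L[ℝ] ℝ)) (BigTangent I (M := M)) x₀ ⟨x, c⟩).2.2 =
      c.2.comp (mfderivWithin 𝓘(ℝ, E) I (extChartAt I x₀).symm (range I)
        (extChartAt I x₀ x)) := by
  have : IsManifold I 1 M := .of_le (n := ∞) (by simp)
  change (trivializationAt (E →L[ℝ] ℝ)
      (fun x : M ↦ TangentSpace I x →L[ℝ] Trivial M ℝ x) x₀ ⟨x, c.2⟩).2 = _
  rw [hom_trivializationAt_apply, ← TangentBundle.symmL_trivializationAt hx]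
  ext v
  simp [ContinuousLinearMap.inCoordinates]
  rfl

/-- The one-form part of a smooth section is differentiable in the preferred chart. -/
theorem SmoothSection.differentiableWithinAt_formInChart [IsManifold I ∞ M]
    {s : Π x : M, BigTangent I x} (hs : SmoothSection I s) (x₀ : M) :
    DifferentiableWithinAt ℝ (formInChart I (fun x ↦ (s x).2) x₀) (range I)
      (extChartAt I x₀ x₀) := by
  have h₁ := (contMDiffAt_section (E := BigTangent I (M := M)) x₀).1 (hs x₀)
  have h₂ : ContMDiffAt I 𝓘(ℝ, E →L[ℝ] ℝ) ∞ (fun x ↦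
      (trivializationAt (E × (E →L[ℝ] ℝ)) (BigTangent I (M := M)) x₀ ⟨x, s x⟩).2.2) x₀ :=
    (contDiff_snd.contMDiff (x := _)).comp x₀ h₁
  have hsymm := contMDiffWithinAt_extChartAt_symm_range (I := I) (n := ∞) x₀
    (mem_extChartAt_target (I := I) x₀)
  have h₃ := h₂.comp_contMDiffWithinAt_of_eq hsymm (extChartAt_to_inv x₀)
  refine (h₃.contDiffWithinAt.differentiableWithinAt (by simp)).congr_of_eventuallyEq ?_ ?_
  -- The trivialization formula is available only over the chart domain, so the two expressions
  -- agree near the base point, which suffices for differentiability there.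
  · filter_upwards [extChartAt_target_mem_nhdsWithin (I := I) x₀] with e he
    have hx : (extChartAt I x₀).symm e ∈ (chartAt H x₀).source := by
      simpa using (extChartAt I x₀).map_target he
    simp only [Function.comp_apply]
    rw [bigTangent_trivializationAt_snd hx, (extChartAt I x₀).right_inv he]
    rfl
  · simp only [Function.comp_apply]
    rw [bigTangent_trivializationAt_snd (by simp), (extChartAt I x₀).right_inv (by simp)]
    rfl

theorem GenAlmostContactMetric.differentiableWithinAt_formInChart_eta [IsManifold I ∞ M]
    (S : GenAlmostContactMetric I M) (x₀ : M) :
    DifferentiableWithinAt ℝ (formInChart I S.eta x₀) (range I) (extChartAt I x₀ x₀) :=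
  (S.smooth_Ep.differentiableWithinAt_formInChart x₀).add
    (S.smooth_Em.differentiableWithinAt_formInChart x₀)

/-- In product charts, `e^t α` is the pullback of `α` scaled by `e^t`. -/
theorem formInChart_expForm [IsManifold I 1 M] (α : Π x : M, Cotangent I x) (p : M × ℝ)
    {q : E × ℝ} (hq : q.1 ∈ (extChartAt I p.1).target) :
    formInChart (I.prod 𝓘(ℝ, ℝ)) (expForm α) p q =
      Real.exp q.2 • (formInChart I α p.1 q.1).comp (ContinuousLinearMap.fst ℝ E ℝ) := by
  have hrange : range (I.prod 𝓘(ℝ, ℝ)) = range I ×ˢ univ := by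
    rw [modelWithCorners_prod_coe, range_prodMap]; simp
  have htarget : q ∈ (extChartAt (I.prod 𝓘(ℝ, ℝ)) p).target := by
    rw [extChartAt_prod]
    exact ⟨hq, by simp only [extChartAt_model_space_eq_id, PartialEquiv.refl_target, mem_univ]⟩
  have hqI : q ∈ range (I.prod 𝓘(ℝ, ℝ)) := extChartAt_target_subset_range p htarget
  have huniq : UniqueMDiffWithinAt 𝓘(ℝ, E × ℝ) (range (I.prod 𝓘(ℝ, ℝ))) q :=
    ((I.prod 𝓘(ℝ, ℝ)).uniqueDiffOn q hqI).uniqueMDiffWithinAt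
  have hA := (mdifferentiableWithinAt_extChartAt_symm (I := I.prod 𝓘(ℝ, ℝ)) htarget)
  have hB := (mdifferentiableWithinAt_extChartAt_symm (I := I) hq)
  have hC : MDifferentiableAt 𝓘(ℝ, E × ℝ) 𝓘(ℝ, E) (Prod.fst : E × ℝ → E) q :=
    differentiableAt_fst.mdifferentiableAt
  -- With `φ` the chart at `p.1`, the functions `fst ∘ (φ × id)⁻¹` and `φ⁻¹ ∘ fst` coincide. The
  -- chain rule is applied to each, and `h₄` equates the results.
  have h₁ := mfderiv_comp_mfderivWithin q
    (mdifferentiableAt_fst (I := I) (I' := 𝓘(ℝ, ℝ))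
      (x := (extChartAt (I.prod 𝓘(ℝ, ℝ)) p).symm q)) hA huniq
  have h₂ := mfderivWithin_comp q hB hC.mdifferentiableWithinAt
    (s := range (I.prod 𝓘(ℝ, ℝ))) (fun z hz ↦ by rw [hrange] at hz; exact hz.1) huniq
  have h₃ : mfderivWithin 𝓘(ℝ, E × ℝ) 𝓘(ℝ, E) (Prod.fst : E × ℝ → E)
      (range (I.prod 𝓘(ℝ, ℝ))) q = ContinuousLinearMap.fst ℝ E ℝ := by
    rw [mfderivWithin_eq_fderivWithin]
    exact fderivWithin_fst huniq.uniqueDiffWithinAt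
  rw [h₃] at h₂
  have h₄ := h₁.symm.trans h₂
  exact congrArg (fun L ↦ Real.exp q.2 • (α ((extChartAt I p.1).symm q.1)).comp L) h₄

end Chart

/-- The map is `g × id` after the shear `(x, s) ↦ (x, s + h x)`, which is a bijection for any
function `h`; no linearity enters. -/
theorem bijective_shear_iff {X : Type*} (g : X → X) (h : X → ℝ) :
    Function.Bijective (fun z : X × ℝ ↦ (g z.1, z.2 + h z.1)) ↔ Function.Bijective g := by
  rcases isEmpty_or_nonempty X with hX | hX
  · exact ⟨fun _ ↦ ⟨fun a ↦ hX.elim a, fun a ↦ hX.elim a⟩,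
      fun _ ↦ ⟨fun a ↦ hX.elim a.1, fun a ↦ hX.elim a.1⟩⟩
  let e : X × ℝ ≃ X × ℝ := Equiv.prodShear (Equiv.refl X) fun x ↦ Equiv.addRight (h x)
  rw [show (fun z : X × ℝ ↦ (g z.1, z.2 + h z.1)) = Prod.map g id ∘ e from rfl,
    Function.Bijective.of_comp_iff _ e.bijective, Prod.map_bijective]
  exact and_iff_left Function.bijective_id

/-! ### Linear algebra: the block triangular reduction. -/

section Linear

variable {E : Type*} [NormedAddCommGroup E] [NormedSpace ℝ E]

/-- If `P` is extended to `E × ℝ` by zero in the `ℝ`-direction, then `1 + BP` is block triangular,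
so its invertibility only depends on the restriction of `B` to `E`. -/
theorem bijective_add_comp_inl_iff (B : E × ℝ →L[ℝ] E × ℝ →L[ℝ] ℝ) (C : E →L[ℝ] E →L[ℝ] ℝ)
    (P : (E →L[ℝ] ℝ) → E) (hB : ∀ v w : E, B (v, 0) (w, 0) = C v w) :
    Function.Bijective (fun ξ : E × ℝ →L[ℝ] ℝ ↦
        ξ + B (P (ξ.comp (ContinuousLinearMap.inl ℝ E ℝ)), 0)) ↔
      Function.Bijective (fun ζ : E →L[ℝ] ℝ ↦ ζ + C (P ζ)) := by
  -- A covector on `E × ℝ` is its restriction to `E` together with its value on `∂/∂t`. Conjugation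
  -- by `T` produces a shear whose off-diagonal term is `B (P ζ, 0) (0, 1)`.
  let T : (E × ℝ →L[ℝ] ℝ) ≃ (E →L[ℝ] ℝ) × ℝ :=
    { toFun := fun ξ ↦ (ξ.comp (ContinuousLinearMap.inl ℝ E ℝ), ξ (0, 1))
      invFun := fun z ↦ z.1.coprod (z.2 • ContinuousLinearMap.id ℝ ℝ)
      left_inv := fun ξ ↦ by ext <;> simp
      right_inv := fun z ↦ by ext <;> simp }
  rw [← bijective_shear_iff _ (fun ζ ↦ B (P ζ, 0) (0, 1)),
    ← Function.Bijective.of_comp_iff _ T.bijective, ← Function.Bijective.of_comp_iff' T.bijective]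
  refine iff_of_eq (congrArg _ (funext fun ξ ↦ Prod.ext ?_ rfl))
  ext v
  exact congrArg (ξ (v, 0) + ·) (hB _ v)

end Linear

/-! ### The two-form `d(e^t α)` and the product bivector on `M × ℝ`. -/

section Chart

variable {E : Type*} [NormedAddCommGroup E] [NormedSpace ℝ E] {H : Type*} [TopologicalSpace H]
  {I : ModelWithCorners ℝ E H} {M : Type*} [TopologicalSpace M] [ChartedSpace H M]

/-- Product rule for `e^t α`: along a direction tangent to the slice the factor `e^t` is constant,
so only `α` is differentiated. -/
theorem fderivWithin_formInChart_expForm [IsManifold I 1 M] (α : Π x : M, Cotangent I x)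
    (p : M × ℝ)
    (hα : DifferentiableWithinAt ℝ (formInChart I α p.1) (range I) (extChartAt I p.1 p.1))
    (v w : E) :
    fderivWithin ℝ (formInChart (I.prod 𝓘(ℝ, ℝ)) (expForm α) p) (range (I.prod 𝓘(ℝ, ℝ)))
        (extChartAt (I.prod 𝓘(ℝ, ℝ)) p p) (v, 0) (w, 0) =
      Real.exp p.2 *
        fderivWithin ℝ (formInChart I α p.1) (range I) (extChartAt I p.1 p.1) v w := by
  have hrange : range (I.prod 𝓘(ℝ, ℝ)) = range I ×ˢ univ := by
    rw [modelWithCorners_prod_coe, range_prodMap]; simp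
  have hpt : extChartAt (I.prod 𝓘(ℝ, ℝ)) p p = (extChartAt I p.1 p.1, p.2) := by
    rw [extChartAt_prod]; rfl
  have hmaps : MapsTo (Prod.fst : E × ℝ → E) (range (I.prod 𝓘(ℝ, ℝ))) (range I) := fun z hz ↦ by
    rw [hrange] at hz; exact hz.1
  let q : E × ℝ := (extChartAt I p.1 p.1, p.2)
  let K : (E →L[ℝ] ℝ) →L[ℝ] (E × ℝ →L[ℝ] ℝ) :=
    ContinuousLinearMap.precomp ℝ (ContinuousLinearMap.fst ℝ E ℝ)
  have h₀ : HasFDerivWithinAt (fun z : E × ℝ ↦ formInChart I α p.1 z.1)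
      ((fderivWithin ℝ (formInChart I α p.1) (range I) (extChartAt I p.1 p.1)).comp
        (ContinuousLinearMap.fst ℝ E ℝ)) (range (I.prod 𝓘(ℝ, ℝ))) q :=
    HasFDerivWithinAt.comp q (g := formInChart I α p.1) (t := range I) hα.hasFDerivWithinAt
      hasFDerivWithinAt_fst hmaps
  have h₁ := K.hasFDerivAt.comp_hasFDerivWithinAt q h₀
  have h₂ : HasFDerivWithinAt (fun z : E × ℝ ↦ Real.exp z.2) _
      (range (I.prod 𝓘(ℝ, ℝ))) q :=
    (hasFDerivWithinAt_snd (𝕜 := ℝ) (E := E) (F := ℝ) (p := q)).exp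
  have h₃ := h₂.smul h₁
  have hev : formInChart (I.prod 𝓘(ℝ, ℝ)) (expForm α) p
      =ᶠ[nhdsWithin q (range (I.prod 𝓘(ℝ, ℝ)))]
        fun z ↦ Real.exp z.2 • K (formInChart I α p.1 z.1) := by
    have ht : Filter.Tendsto (Prod.fst : E × ℝ → E) (nhdsWithin q (range (I.prod 𝓘(ℝ, ℝ))))
        (nhdsWithin q.1 (range I)) :=
      (continuous_fst.continuousWithinAt (x := q)).tendsto_nhdsWithin hmaps
    filter_upwards [ht (extChartAt_target_mem_nhdsWithin (I := I) p.1)] with z hz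
    exact formInChart_expForm α p hz
  have h₄ := h₃.congr_of_eventuallyEq hev
    (formInChart_expForm α p (mem_extChartAt_target (I := I) p.1))
  have huniq : UniqueDiffWithinAt ℝ (range (I.prod 𝓘(ℝ, ℝ))) q := by
    rw [show q = _ from hpt.symm]
    exact (I.prod 𝓘(ℝ, ℝ)).uniqueDiffOn _
      (extChartAt_target_subset_range p (mem_extChartAt_target p))
  rw [hpt, h₄.fderivWithin huniq]
  -- The term containing the derivative of `exp` vanishes because `(v, 0)` has zero `ℝ`-component.
  simp [K, q]

theorem mfderiv_extChartAt_prod_apply_inl [IsManifold I 1 M] (p : M × ℝ)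
    (v : TangentSpace I p.1) :
    mfderiv (I.prod 𝓘(ℝ, ℝ)) 𝓘(ℝ, E × ℝ) (extChartAt (I.prod 𝓘(ℝ, ℝ)) p) p ((v, 0) : E × ℝ) =
      ((mfderiv I 𝓘(ℝ, E) (extChartAt I p.1) p.1 v, 0) : E × ℝ) := by
  have h : ⇑(extChartAt (I.prod 𝓘(ℝ, ℝ)) p) = Prod.map (extChartAt I p.1) id := by
    rw [extChartAt_prod]; rfl
  have h' := mfderiv_prodMap (p := p) (mdifferentiableAt_extChartAt (I := I) (x := p.1)
    (mem_chart_source H p.1)) (mdifferentiableAt_id (I := 𝓘(ℝ, ℝ)) (x := p.2))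
  -- The self-model and charted structure on `E × ℝ` are rewritten as products, the form in which
  -- `mfderiv_prodMap` computes the derivative.
  rw [h, modelWithCornersSelf_prod, ← chartedSpaceSelf_prod]
  refine (congrArg (fun L ↦ L ((v, 0) : E × ℝ)) h').trans ?_
  exact Prod.ext rfl (map_zero (mfderiv 𝓘(ℝ, ℝ) 𝓘(ℝ, ℝ) (id : ℝ → ℝ) p.2))

/-- Along the slices `M × {t}`, the two-form `d(e^t α)` restricts to `e^t dα`. -/
theorem dForm_expForm_apply_inl [IsManifold I 1 M] (α : Π x : M, Cotangent I x) (p : M × ℝ)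
    (hα : DifferentiableWithinAt ℝ (formInChart I α p.1) (range I) (extChartAt I p.1 p.1))
    (v w : E) :
    dForm (I.prod 𝓘(ℝ, ℝ)) (expForm α) p ((v, 0) : E × ℝ) ((w, 0) : E × ℝ) =
      (Real.exp p.2 • dForm I α p.1) v w := by
  let A : E →L[ℝ] E := mfderiv I 𝓘(ℝ, E) (extChartAt I p.1) p.1
  let D := fderivWithin ℝ (formInChart I α p.1) (range I) (extChartAt I p.1 p.1)
  let D' := fderivWithin ℝ (formInChart (I.prod 𝓘(ℝ, ℝ)) (expForm α) p)
    (range (I.prod 𝓘(ℝ, ℝ))) (extChartAt (I.prod 𝓘(ℝ, ℝ)) p p)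
  let A' : E × ℝ →L[ℝ] E × ℝ :=
    mfderiv (I.prod 𝓘(ℝ, ℝ)) 𝓘(ℝ, E × ℝ) (extChartAt (I.prod 𝓘(ℝ, ℝ)) p) p
  have hA (u : E) : A' (u, 0) = (A u, 0) := mfderiv_extChartAt_prod_apply_inl p u
  have hD (u u' : E) : D' (u, 0) (u', 0) = Real.exp p.2 * D u u' :=
    fderivWithin_formInChart_expForm α p hα u u'
  change D' (A' (v, 0)) (A' (w, 0)) - D' (A' (w, 0)) (A' (v, 0)) =
    Real.exp p.2 * (D (A v) (A w) - D (A w) (A v))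
  rw [hA, hA, hD, hD, mul_sub]

/-- The slice inclusion `x ↦ (x, t)` has derivative `inl`, so pulling a covector back along it is
restriction to `TM` and pushing a vector forward appends a zero. This is the shape required by
`bijective_add_comp_inl_iff`. -/
theorem prodBivector_zero_right (π₁ : Π x : M, Cotangent I x →L[ℝ] TangentSpace I x)
    {π₂ : Π t : ℝ, Cotangent 𝓘(ℝ, ℝ) t →L[ℝ] TangentSpace 𝓘(ℝ, ℝ) t} (hπ₂ : ∀ t, π₂ t = 0)
    (p : M × ℝ) (ξ : E × ℝ →L[ℝ] ℝ) :
    prodBivector (I := I) (J := 𝓘(ℝ, ℝ)) π₁ π₂ p ξ =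
      ((π₁ p.1 (ξ.comp (ContinuousLinearMap.inl ℝ E ℝ)), 0) : E × ℝ) := by
  have hi : mfderiv I (I.prod 𝓘(ℝ, ℝ)) (fun x : M ↦ (x, p.2)) p.1 =
    ContinuousLinearMap.inl ℝ E ℝ := mfderiv_prod_left
  let j : ℝ →L[ℝ] E × ℝ := mfderiv 𝓘(ℝ, ℝ) (I.prod 𝓘(ℝ, ℝ)) (fun t : ℝ ↦ (p.1, t)) p.2
  have h : j (π₂ p.2 (ξ.comp j)) = 0 := by
    rw [hπ₂]
    exact map_zero j
  simp only [prodBivector, hi]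
  exact (congrArg (((π₁ p.1 (ξ.comp (ContinuousLinearMap.inl ℝ E ℝ)), 0) : E × ℝ) + ·) h).trans
    (add_zero _)

end Chart

/-- Here `Φ = 0` kills `π₀`, and `E₊ = dt` has no vector part, so `e₊ ∧ e₋ = 0`. -/
theorem line_poisson (t : ℝ) : line.poisson t = 0 := by
  ext ξ
  let c : ℝ →L[ℝ] ℝ := ξ
  change (0 : ℝ) + (c 0 * 1 - c 1 * 0) = 0
  simp

end GenContact

open GenContact in
theorem theorem5p1 {n : ℕ} {M : Type*} [TopologicalSpace M] [T2Space M]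
    [SecondCountableTopology M] [ChartedSpace (EuclideanSpace ℝ (Fin n)) M] [IsManifold (𝓡 n) ∞ M]
    (S : GenAlmostContactMetric (𝓡 n) M) (hS : S.IsNormal) :
    InvertibleGauge (dForm ((𝓡 n).prod 𝓘(ℝ, ℝ)) (expForm S.eta))
        (prodBivector S.poisson line.poisson) ↔
      ∀ t : ℝ, InvertibleGauge (fun x : M ↦ Real.exp t • dForm (𝓡 n) S.eta x) S.poisson := by
  have : IsManifold (𝓡 n) 1 M := .of_le (n := ∞) (by simp)
  have key (p : M × ℝ) := bijective_add_comp_inl_iff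
    (dForm ((𝓡 n).prod 𝓘(ℝ, ℝ)) (expForm S.eta) p) (Real.exp p.2 • dForm (𝓡 n) S.eta p.1)
    (S.poisson p.1) (dForm_expForm_apply_inl S.eta p
      (S.differentiableWithinAt_formInChart_eta p.1))
  have hP (p : M × ℝ) := prodBivector_zero_right S.poisson line_poisson p
  have key' (p : M × ℝ) : Function.Bijective (fun ξ : Cotangent ((𝓡 n).prod 𝓘(ℝ, ℝ)) p ↦
      ξ + dForm ((𝓡 n).prod 𝓘(ℝ, ℝ)) (expForm S.eta) p
        (prodBivector S.poisson line.poisson p ξ)) ↔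
      Function.Bijective (fun ζ : Cotangent (𝓡 n) p.1 ↦
        ζ + (Real.exp p.2 • dForm (𝓡 n) S.eta p.1) (S.poisson p.1 ζ)) := by
    refine (iff_of_eq (congrArg _ (funext fun ξ ↦ ?_))).trans (key p)
    exact congrArg (fun v ↦ ξ + dForm ((𝓡 n).prod 𝓘(ℝ, ℝ)) (expForm S.eta) p v) (hP p ξ)
  -- A fibre over `M × ℝ` is indexed by a pair `(x, t)`, so letting `p` vary amounts to quantifying
  -- over all `t` and then all fibres over `M`.
  exact ⟨fun h t x ↦ (key' (x, t)).1 (h (x, t)), fun h p ↦ (key' p).2 (h p.2 p.1)⟩
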